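/- \textbf{Theorem 1.} Let $\lambda,r,\rho,\theta>0$, $\alpha>2$, $\eta\in(0,1]$ and $A\in\{0,1,2,\dots\}$. Consider a link of length $r$ (the typical link) with its receiver at the origin of the plane, in slotted time $t=0,1,2,\dots$. In slot $t$ the interfering sources are located at the points $X_1(t),X_2(t),\dots$ of a homogeneous Poisson point process of density $\lambda$ on $\mathbb{R}^2$; let $h_{00}(t)$ and $h_{i0}(t)$, $i\ge 1$, be exponential random variables of mean $1$ (Rayleigh fading), $b_0(t),b_i(t)$, $i\ge1$, Bernoulli random variables with parameter $\eta$, and $\Delta_i(t)\in\{0,1,2,\dots\}$, $i\ge 1$, the ages of information of the interfering links. Interferer $i$ is active in slot $t$, written $v_i(t)=1$, if $\Delta_i(t)>A$ and $b_i(t)=1$, and $v_i(t)=0$ otherwise (age-threshold slotted ALOHA, TSA). Put $$\mathrm{SINR}_0(t)=\frac{h_{00}(t)\,r^{-\alpha}}{\sum_{i\ge1}h_{i0}(t)\,v_i(t)\,\|X_i(t)\|^{-\alpha}+\rho^{-1}} .$$ The age of the typical link starts from a random $\Delta_0(0)\in\{0,1,2,\dots\}$ and evolves by $\Delta_0(t+1)=1$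 if $\Delta_0(t)>A$, $b_0(t)=1$ and $\mathrm{SINR}_0(t)>\theta$, and $\Delta_0(t+1)=\Delta_0(t)+1$ otherwise. Assume: \begin{itemize} \item (high mobility and mean-field independence) the random elements $\Delta_0(0)$, $(X_i(t))_{i\ge1}$, $h_{00}(t)$, $h_{i0}(t)$, $b_0(t)$, $b_i(t)$, $\Delta_i(t)$, over all $t\ge0$ and $i\ge1$, are mutually independent; \item (symmetry) for all $t$ and all $i\ge1$, $\Delta_i(t)$ has the same distribution as $\Delta_0(t)$; \item (steady state) the distribution of $\Delta_0(t)$ does not depend on $t$. \end{itemize} Then the transmission success probability $p_{\mathrm s}=\mathbb{P}(\mathrm{SINR}_0(t)>\theta)$ does not depend on $t$ and solves the fixed-point equation $$p_{\mathrm s}=\exp\left(-\frac{\lambda c\,\eta\, r^2}{1+A\eta\, p_{\mathrm s}}-\frac{\theta r^{\alpha}}{\rho}\right),\qquad c=\pi\,\theta^{2/\alpha}\,\Gamma\!\left(1-\tfrac{2}{\alpha}\right)\Gamma\!\left(1+\tfrac{2}{\alpha}\right).$$ -/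

import Mathlib

open MeasureTheory ProbabilityTheory

open scoped ENNReal

namespace TSA

/-- The Euclidean plane, with its Borel sets and Lebesgue measure. -/
abbrev Plane : Type := EuclideanSpace ℝ (Fin 2)

/-- Number of points of the configuration `x 0, x 1, …` that lie in `B`. -/
noncomputable def pointCount (x : ℕ → Plane) (B : Set Plane) : ℕ∞ :=
  {i : ℕ | x i ∈ B}.encard

/-- `X` enumerates a homogeneous Poisson point process of density `lam` on the plane: the number of
points in a Borel set of finite area is Poisson with mean `lam` times the area, and the numbers of
points in pairwise disjoint such sets are independent. -/
structure IsHPPP {Ω : Type*} [MeasurableSpace Ω] (P : Measure Ω) (lam : ℝ)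
    (X : Ω → ℕ → Plane) : Prop where
  measurable : Measurable X
  count_law : ∀ B : Set Plane, MeasurableSet B → volume B ≠ ∞ → ∀ n : ℕ,
    P {ω | pointCount (X ω) B = n} = poissonMeasure (lam * (volume B).toReal).toNNReal {n}
  count_indep : ∀ (m : ℕ) (B : Fin m → Set Plane), (∀ k, MeasurableSet (B k)) →
    (∀ k, volume (B k) ≠ ∞) → Pairwise (fun j k => Disjoint (B j) (B k)) →
    iIndepFun (fun k ω => pointCount (X ω) (B k)) P

/-- Network parameters: deployment density, link length, path-loss exponent, signal-to-noise ratio,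
decoding threshold, update rate, age threshold. -/
structure Params where
  lam : ℝ
  r : ℝ
  α : ℝ
  ρ : ℝ
  θ : ℝ
  η : ℝ
  A : ℕ

/-- The admissible range of the parameters. -/
structure Params.Admissible (par : Params) : Prop where
  lam_pos : 0 < par.lam
  r_pos : 0 < par.r
  two_lt_α : 2 < par.α
  ρ_pos : 0 < par.ρ
  θ_pos : 0 < par.θ
  η_pos : 0 < par.η
  η_le_one : par.η ≤ 1

/-- The spatial contention constant `π θ^(2/α) Γ(1 - 2/α) Γ(1 + 2/α)`. -/
noncomputable def Params.c (par : Params) : ℝ :=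
  Real.pi * par.θ ^ (2 / par.α) * Real.Gamma (1 - 2 / par.α) * Real.Gamma (1 + 2 / par.α)

/-- The random elements seen by the typical link, whose receiver is at the origin and whose
transmitter is at distance `r`. Slots are indexed by `t`; in each slot the interfering sources are
enumerated by `i`. A coin is the decision of a source to send an update when it is allowed to. -/
structure Network (Ω : Type*) where
  /-- age of information of the typical link in slot `0` -/
  initialAge : Ω → ℕ
  /-- fading of the typical link -/
  ownFading : ℕ → Ω → ℝ
  /-- coin of the typical source -/
  ownCoin : ℕ → Ω → Bool
  /-- locations of the interfering sources -/
  position : ℕ → Ω → ℕ → Plane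
  /-- fading between interfering source `i` and the typical receiver -/
  fading : ℕ → ℕ → Ω → ℝ
  /-- coin of interfering source `i` -/
  coin : ℕ → ℕ → Ω → Bool
  /-- age of information of the link of interfering source `i` -/
  interfererAge : ℕ → ℕ → Ω → ℕ

namespace Network

variable {Ω : Type*}

/-- Threshold slotted ALOHA: interfering source `i` transmits in slot `t` when its age exceeds `A`
and its coin shows `true`. -/
def Transmits (N : Network Ω) (par : Params) (t i : ℕ) (ω : Ω) : Prop :=
  par.A < N.interfererAge t i ω ∧ N.coin t i ω = true

open Classical in
/-- The interference at the typical receiver in slot `t`, as an extended nonnegative number. -/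
noncomputable def interference (N : Network Ω) (par : Params) (t : ℕ) (ω : Ω) : ℝ≥0∞ :=
  ∑' i, if N.Transmits par t i ω then
    ENNReal.ofReal (N.fading t i ω * ‖N.position t ω i‖ ^ (-par.α)) else 0

/-- The signal to interference plus noise ratio at the typical receiver in slot `t`. -/
noncomputable def sinr (N : Network Ω) (par : Params) (t : ℕ) (ω : Ω) : ℝ≥0∞ :=
  ENNReal.ofReal (N.ownFading t ω * par.r ^ (-par.α)) /
    (N.interference par t ω + ENNReal.ofReal par.ρ⁻¹)

open Classical in
/-- The age of information of the typical link under threshold slotted ALOHA: it is reset to one by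
a successful transmission and grows by one in every other slot. -/
noncomputable def age (N : Network Ω) (par : Params) : ℕ → Ω → ℕ
  | 0, ω => N.initialAge ω
  | t + 1, ω =>
    if par.A < N.age par t ω ∧ N.ownCoin t ω = true ∧ ENNReal.ofReal par.θ < N.sinr par t ω then 1
    else N.age par t ω + 1

/-- The transmission success probability of the typical link in slot `t`. -/
noncomputable def successProb [MeasurableSpace Ω] (N : Network Ω) (par : Params) (P : Measure Ω)
    (t : ℕ) : ℝ :=
  P.real {ω | ENNReal.ofReal par.θ < N.sinr par t ω}

end Network

/-- Names of the elementary random elements of a network. -/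
inductive Source : Type
  | initialAge
  | ownFading (t : ℕ)
  | ownCoin (t : ℕ)
  | position (t : ℕ)
  | fading (t i : ℕ)
  | coin (t i : ℕ)
  | interfererAge (t i : ℕ)

/-- The space in which an elementary random element takes its values. -/
def Source.Val : Source → Type
  | .initialAge => ℕ
  | .ownFading _ => ℝ
  | .ownCoin _ => Bool
  | .position _ => ℕ → Plane
  | .fading _ _ => ℝ
  | .coin _ _ => Bool
  | .interfererAge _ _ => ℕ

noncomputable instance Source.instMeasurableSpaceVal : (s : Source) → MeasurableSpace s.Val
  | .initialAge => inferInstanceAs (MeasurableSpace ℕ)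
  | .ownFading _ => inferInstanceAs (MeasurableSpace ℝ)
  | .ownCoin _ => inferInstanceAs (MeasurableSpace Bool)
  | .position _ => inferInstanceAs (MeasurableSpace (ℕ → Plane))
  | .fading _ _ => inferInstanceAs (MeasurableSpace ℝ)
  | .coin _ _ => inferInstanceAs (MeasurableSpace Bool)
  | .interfererAge _ _ => inferInstanceAs (MeasurableSpace ℕ)

/-- The elementary random elements of a network as one family. -/
def Network.element {Ω : Type*} (N : Network Ω) : (s : Source) → Ω → s.Val
  | .initialAge => N.initialAge
  | .ownFading t => N.ownFading t
  | .ownCoin t => N.ownCoin t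
  | .position t => N.position t
  | .fading t i => N.fading t i
  | .coin t i => N.coin t i
  | .interfererAge t i => N.interfererAge t i

/-- The Poisson bipolar network with Rayleigh fading, high mobility and threshold slotted ALOHA, in
the mean-field regime and in steady state. -/
structure Network.IsMeanFieldTSA {Ω : Type*} [MeasurableSpace Ω] (N : Network Ω) (par : Params)
    (P : Measure Ω) : Prop where
  measurable : ∀ s, Measurable (N.element s)
  /-- High mobility: everything is redrawn independently in every slot. Mean field: the ages of the
  interferers (hence their activities) are independent of each other and of everything else. -/
  indep : iIndepFun N.element P
  /-- The interfering sources form a homogeneous Poisson point process. -/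
  position_law : ∀ t, IsHPPP P par.lam (N.position t)
  /-- Rayleigh fading of unit mean power. -/
  ownFading_law : ∀ t, HasLaw (N.ownFading t) (expMeasure 1) P
  fading_law : ∀ t i, HasLaw (N.fading t i) (expMeasure 1) P
  /-- Update rate `η`. -/
  ownCoin_law : ∀ t, P {ω | N.ownCoin t ω = true} = ENNReal.ofReal par.η
  coin_law : ∀ t i, P {ω | N.coin t i ω = true} = ENNReal.ofReal par.η
  /-- Symmetry: the age of an interferer is distributed as the age of the typical link. -/
  symmetric : ∀ t i, IdentDistrib (N.interfererAge t i) (N.age par t) P P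
  /-- Steady state: the distribution of the age of the typical link does not change in time. -/
  stationary : ∀ t, IdentDistrib (N.age par t) (N.age par 0) P P

end TSA

/-! Let q be the steady-state probability that the age exceeds the threshold `A`. Two relations
between q and p_s give the fixed point.

Radio side (`successProb_eq_exp`): the event SINR > θ says that the exponential fading of the
typical link exceeds s(I + 1/ρ), with s = θ r^α and I the interference. Hence p_s = E[exp(-sI)]
exp(-s/ρ). An interferer is active with probability qη, by symmetry and stationarity, so I is a shot
noise of a Poisson process with i.i.d. marks. The marked Laplace functional
(`IsHPPP.lintegral_expNeg_tsum_marks`) and the planar integral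
`lintegral_one_sub_expNeg_mul_norm_rpow` give E[exp(-sI)] = exp(-q λ c η r²).

Age side (`measureReal_threshold_lt_age`): stationarity between slots 0 and 1 gives age 0 mass zero,
age 1 the probability q η p_s of a reset, and ages 1, …, A the same mass, since no reset can occur
up to age `A`. Therefore 1 - q = A q η p_s, that is q = 1 / (1 + A η p_s).

All integrals take values in [0, ∞], so neither finiteness of the interference nor integrability
needs a separate argument. -/

namespace TSA

open Filter Topology

/-! ### Negative exponential on [0, ∞] and the Poisson Laplace transform -/

/-- The function `x ↦ exp (-x)` on the extended nonnegative numbers. -/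
noncomputable def expNeg (x : ℝ≥0∞) : ℝ≥0∞ := EReal.exp (-(x : EReal))

lemma expNeg_zero : expNeg 0 = 1 := by simp [expNeg]

lemma expNeg_top : expNeg ∞ = 0 := by simp [expNeg]

lemma expNeg_ofReal {x : ℝ} (hx : 0 ≤ x) :
    expNeg (ENNReal.ofReal x) = ENNReal.ofReal (Real.exp (-x)) := by
  rw [expNeg, EReal.coe_ennreal_ofReal, max_eq_left hx, ← EReal.coe_neg, EReal.exp_coe]

lemma expNeg_add (x y : ℝ≥0∞) : expNeg (x + y) = expNeg x * expNeg y := by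
  rw [expNeg, expNeg, expNeg, ← EReal.exp_add, EReal.coe_ennreal_add, EReal.neg_add (by simp)
    (by simp), sub_eq_add_neg]

lemma expNeg_sum {ι : Type*} (s : Finset ι) (f : ι → ℝ≥0∞) :
    expNeg (∑ i ∈ s, f i) = ∏ i ∈ s, expNeg (f i) := by
  classical
  induction s using Finset.induction_on with
  | empty => simp [expNeg_zero]
  | insert a s ha ih => rw [Finset.sum_insert ha, Finset.prod_insert ha, expNeg_add, ih]

lemma expNeg_le_one (x : ℝ≥0∞) : expNeg x ≤ 1 := by
  rw [expNeg, EReal.exp_le_one_iff, EReal.neg_le, neg_zero]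
  exact EReal.coe_ennreal_nonneg x

lemma continuous_expNeg : Continuous expNeg :=
  ENNReal.continuous_exp.comp (continuous_neg.comp continuous_coe_ennreal_ereal)

lemma measurable_expNeg : Measurable expNeg := continuous_expNeg.measurable

/-- Lets a mean over marks be written as exp(-f) for a deterministic f of the location; y = 0
corresponds to f = ∞. -/
lemma expNeg_toENNReal_neg_log {y : ℝ≥0∞} (hy : y ≤ 1) : expNeg (-(ENNReal.log y)).toENNReal = y := by
  rw [expNeg, EReal.coe_toENNReal, neg_neg, ENNReal.exp_log]
  rw [EReal.le_neg]
  simpa using hy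

lemma expNeg_antitone : Antitone expNeg := fun x y h => by
  simpa [expNeg] using h

lemma lintegral_poissonMeasure (m : NNReal) (f : ℕ → ℝ≥0∞) :
    ∫⁻ n, f n ∂(poissonMeasure m) =
      ∑' n : ℕ, ENNReal.ofReal (Real.exp (-m) * m ^ n / n.factorial) * f n := by
  rw [poissonMeasure, lintegral_sum_measure]
  simp

/-- The Laplace transform of a Poisson distribution. -/
lemma lintegral_expNeg_poissonMeasure (m : NNReal) {a : ℝ≥0∞} (ha : a ≠ ∞) :
    ∫⁻ n, expNeg (a * n) ∂(poissonMeasure m) = expNeg (m * (1 - expNeg a)) := by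
  obtain ⟨a, ha0, rfl⟩ : ∃ b : ℝ, 0 ≤ b ∧ a = ENNReal.ofReal b :=
    ⟨a.toReal, ENNReal.toReal_nonneg, (ENNReal.ofReal_toReal ha).symm⟩
  rw [lintegral_poissonMeasure]
  have h1 : ∀ n : ℕ, ENNReal.ofReal (Real.exp (-m) * m ^ n / n.factorial) *
      expNeg (ENNReal.ofReal a * n) =
      ENNReal.ofReal (Real.exp (-m) * ((m * Real.exp (-a)) ^ n / n.factorial)) := by
    intro n
    rw [← ENNReal.ofReal_natCast, ← ENNReal.ofReal_mul ha0, expNeg_ofReal (by positivity),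
      ← ENNReal.ofReal_mul (by positivity), mul_pow, ← Real.exp_nat_mul]
    congr 1
    rw [show (n : ℝ) * -a = -(a * n) by ring]
    ring
  have h2 := ((NormedSpace.expSeries_div_hasSum_exp (m * Real.exp (-a))).mul_left
    (Real.exp (-m)))
  simp_rw [h1]
  rw [← ENNReal.ofReal_tsum_of_nonneg (fun n => by positivity) h2.summable, h2.tsum_eq,
    ← Real.exp_eq_exp_ℝ, ← Real.exp_add, expNeg_ofReal ha0, ← ENNReal.ofReal_one,
    ← ENNReal.ofReal_sub _ (Real.exp_nonneg _), ← ENNReal.ofReal_coe_nnreal,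
    ← ENNReal.ofReal_mul m.coe_nonneg, expNeg_ofReal]
  · congr 2
    ring
  · exact mul_nonneg m.coe_nonneg (by simpa using ha0)

lemma toENNReal_pointCount (x : ℕ → Plane) (B : Set Plane) :
    (pointCount x B : ℝ≥0∞) = ∑' i, B.indicator 1 (x i) := by
  rw [pointCount, ← ENNReal.tsum_set_one, tsum_subtype {i | x i ∈ B} (fun _ => (1 : ℝ≥0∞))]
  rfl

/-! ### Laplace functional of the Poisson process -/

section Laplace

variable {Ω : Type*} [MeasurableSpace Ω] {P : Measure Ω} {lam : ℝ} {X : Ω → ℕ → Plane}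

lemma measurable_pointCount (hX : Measurable X) {B : Set Plane} (hB : MeasurableSet B) :
    Measurable fun ω => pointCount (X ω) B := by
  refine measurable_encard.comp ?_
  rw [measurable_set_iff]
  intro i
  exact hB.mem.comp ((measurable_pi_apply i).comp hX)

/-- `count_law` prescribes only the masses of finite counts. These already sum to one, so an
infinite count has probability zero; formally, domination between two probability measures forces
equality. -/
lemma IsHPPP.map_pointCount [IsProbabilityMeasure P] (hX : IsHPPP P lam X) {B : Set Plane}
    (hB : MeasurableSet B) (hB' : volume B ≠ ∞) :
    P.map (fun ω => pointCount (X ω) B) =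
      (poissonMeasure (lam * (volume B).toReal).toNNReal).map (Nat.cast : ℕ → ℕ∞) := by
  have hm := measurable_pointCount hX.measurable hB
  have := Measure.isProbabilityMeasure_map (μ := P) hm.aemeasurable
  symm
  refine Measure.eq_of_le_of_isProbabilityMeasure ?_
  rw [Measure.le_iff]
  intro s _
  have key : ∀ n : ℕ∞, (poissonMeasure (lam * (volume B).toReal).toNNReal).map
      (Nat.cast : ℕ → ℕ∞) {n} ≤ P.map (fun ω => pointCount (X ω) B) {n} := by
    intro n
    rw [Measure.map_apply .of_discrete (.singleton _), Measure.map_apply hm (.singleton _)]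
    induction n using ENat.recTopCoe with
    | top => simp [Set.preimage]
    | coe n =>
      have h1 : (Nat.cast : ℕ → ℕ∞) ⁻¹' {(n : ℕ∞)} = {n} := by ext; simp
      rw [h1, ← hX.count_law B hB hB' n]
      rfl
  rw [← Measure.tsum_indicator_apply_singleton _ _ (Set.to_countable s).measurableSet,
    ← Measure.tsum_indicator_apply_singleton _ _ (Set.to_countable s).measurableSet]
  exact ENNReal.tsum_le_tsum fun n => Set.indicator_le_indicator (key n)

lemma IsHPPP.lintegral_expNeg_pointCount [IsProbabilityMeasure P] (hlam : 0 ≤ lam)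
    (hX : IsHPPP P lam X) {B : Set Plane}
    (hB : MeasurableSet B) (hB' : volume B ≠ ∞) {a : ℝ≥0∞} (ha : a ≠ ∞) :
    ∫⁻ ω, expNeg (a * pointCount (X ω) B) ∂P =
      expNeg (ENNReal.ofReal lam * ((1 - expNeg a) * volume B)) := by
  have hg : Measurable fun n : ℕ∞ => expNeg (a * n) := .of_discrete
  rw [← lintegral_map (f := fun n : ℕ∞ => expNeg (a * n)) hg
    (measurable_pointCount hX.measurable hB), hX.map_pointCount hB hB',
    lintegral_map hg .of_discrete]
  simp only [ENat.toENNReal_coe]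
  rw [lintegral_expNeg_poissonMeasure _ ha]
  congr 1
  change ENNReal.ofReal (lam * (volume B).toReal) * _ = _
  rw [ENNReal.ofReal_mul hlam, ENNReal.ofReal_toReal hB']
  ring

lemma tsum_simpleFunc_eq_sum_pointCount (f : SimpleFunc Plane ℝ≥0∞) (x : ℕ → Plane) :
    ∑' i, f (x i) = ∑ y ∈ f.range with y ≠ 0, y * pointCount x (f ⁻¹' {y}) := by
  classical
  simp_rw [toENNReal_pointCount, ← ENNReal.tsum_mul_left]
  rw [← Summable.tsum_finsetSum (fun _ _ => ENNReal.summable)]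
  congr 1 with i
  by_cases h : f (x i) = 0
  · rw [h, Finset.sum_eq_zero]
    intro y hy
    have : y ≠ 0 := by simpa using (Finset.mem_filter.1 hy).2
    simp [Set.indicator, h, this.symm]
  · rw [Finset.sum_eq_single (f (x i))]
    · simp
    · intro y _ hy
      simp [Set.indicator, hy.symm]
    · simp [h]

/-- The sum is a linear combination of the counts in the level sets of `f`. These are disjoint and,
away from the value 0, of finite area, so the counts are independent and the Poisson transforms
multiply. -/
lemma IsHPPP.lintegral_expNeg_tsum_simpleFunc [IsProbabilityMeasure P] (hlam : 0 ≤ lam)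
    (hX : IsHPPP P lam X) (f : SimpleFunc Plane ℝ≥0∞)
    (hf : ∀ y ≠ 0, volume (f ⁻¹' {y}) ≠ ∞) (hf' : ∀ x, f x ≠ ∞) :
    ∫⁻ ω, expNeg (∑' i, f (X ω i)) ∂P =
      expNeg (ENNReal.ofReal lam * ∫⁻ x, (1 - expNeg (f x))) := by
  classical
  set s : Finset ℝ≥0∞ := {y ∈ f.range | y ≠ 0} with hs
  have hs0 : ∀ y ∈ s, y ≠ 0 := fun y hy => (Finset.mem_filter.1 hy).2
  have hst : ∀ y ∈ s, y ≠ ∞ := fun y hy => by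
    obtain ⟨x, rfl⟩ := SimpleFunc.mem_range.1 (Finset.mem_filter.1 hy).1
    exact hf' x
  let e := s.equivFin
  have hind := hX.count_indep s.card (fun k => f ⁻¹' {(e.symm k : ℝ≥0∞)})
    (fun k => f.measurableSet_preimage _) (fun k => hf _ (hs0 _ (e.symm k).2))
    (fun j k hjk => Disjoint.preimage _ (by simpa [Subtype.ext_iff] using hjk))
  have hind2 := hind.comp (fun k n => expNeg ((e.symm k : ℝ≥0∞) * n)) (fun k => .of_discrete)
  have h1 : ∀ ω, expNeg (∑' i, f (X ω i)) = ∏ k, expNeg ((e.symm k : ℝ≥0∞) *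
      pointCount (X ω) (f ⁻¹' {(e.symm k : ℝ≥0∞)})) := by
    intro ω
    rw [tsum_simpleFunc_eq_sum_pointCount, expNeg_sum, ← hs, ← Finset.prod_coe_sort,
      ← e.symm.prod_comp]
  simp_rw [h1]
  have h2 := lintegral_prod_eq_prod_lintegral_of_indepFun Finset.univ _ hind2 (fun k =>
    Measurable.comp .of_discrete (measurable_pointCount hX.measurable (f.measurableSet_preimage _)))
  simp only [Function.comp_def] at h2
  rw [h2]
  simp_rw [hX.lintegral_expNeg_pointCount hlam (f.measurableSet_preimage _)
    (hf _ (hs0 _ (e.symm _).2)) (hst _ (e.symm _).2)]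
  rw [← expNeg_sum, ← Finset.mul_sum]
  congr 2
  rw [e.symm.sum_comp (fun y : s => (1 - expNeg y) * volume (f ⁻¹' {(y : ℝ≥0∞)})),
    Finset.sum_coe_sort s (fun y => (1 - expNeg y) * volume (f ⁻¹' {y})), hs,
    Finset.sum_filter_of_ne, ← SimpleFunc.map_lintegral (fun y => 1 - expNeg y),
    ← SimpleFunc.lintegral_eq_lintegral]
  · rfl
  · rintro y _ h rfl
    simp [expNeg_zero] at h

lemma tendsto_lintegral_expNeg [IsFiniteMeasure P] {F : ℕ → Ω → ℝ≥0∞} {f : Ω → ℝ≥0∞}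
    (hF : ∀ n, Measurable (F n)) (h : ∀ ω, Tendsto (fun n => F n ω) atTop (𝓝 (f ω))) :
    Tendsto (fun n => ∫⁻ ω, expNeg (F n ω) ∂P) atTop (𝓝 (∫⁻ ω, expNeg (f ω) ∂P)) := by
  refine tendsto_lintegral_of_dominated_convergence (fun _ => 1)
    (fun n => measurable_expNeg.comp (hF n)) (fun n => ae_of_all _ fun ω => expNeg_le_one _) ?_
    (ae_of_all _ fun ω => (continuous_expNeg.tendsto _).comp (h ω))
  simp

/-- The Laplace functional of a homogeneous Poisson point process. -/
theorem IsHPPP.lintegral_expNeg_tsum [IsProbabilityMeasure P] (hlam : 0 ≤ lam)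
    (hX : IsHPPP P lam X) {f : Plane → ℝ≥0∞} (hf : Measurable f) :
    ∫⁻ ω, expNeg (∑' i, f (X ω i)) ∂P =
      expNeg (ENNReal.ofReal lam * ∫⁻ x, (1 - expNeg (f x))) := by
  -- Truncation to balls makes the nonzero level sets of the approximating simple functions have
  -- finite area, while keeping the sequence increasing to `f`.
  let F : ℕ → SimpleFunc Plane ℝ≥0∞ := fun n =>
    (SimpleFunc.eapprox f n).restrict (Metric.ball 0 n)
  have hF : ∀ n x, F n x = (Metric.ball 0 (n : ℝ)).indicator (SimpleFunc.eapprox f n) x :=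
    fun n x => SimpleFunc.restrict_apply _ Metric.isOpen_ball.measurableSet x
  have hmono : Monotone fun n x => F n x := by
    intro m n hmn x
    simp only [hF]
    refine (Set.indicator_le_indicator (SimpleFunc.monotone_eapprox f hmn x)).trans ?_
    exact Set.indicator_le_indicator_of_subset (Metric.ball_subset_ball (by exact_mod_cast hmn))
      (fun _ => zero_le) x
  have hlim : ∀ x, Tendsto (fun n => F n x) atTop (𝓝 (f x)) := by
    intro x
    refine (SimpleFunc.tendsto_eapprox hf x).congr' ?_
    obtain ⟨n₀, hn₀⟩ := exists_nat_gt ‖x‖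
    filter_upwards [eventually_ge_atTop n₀] with n hn
    have : x ∈ Metric.ball (0 : Plane) n := by
      simpa using hn₀.trans_le (by exact_mod_cast hn)
    rw [hF, Set.indicator_of_mem this]
  have hsupp : ∀ n, ∀ y ≠ 0, volume (F n ⁻¹' {y}) ≠ ∞ := by
    intro n y hy
    refine ne_top_of_le_ne_top (measure_ball_lt_top (μ := volume) (x := (0 : Plane))
      (r := n)).ne (measure_mono fun x hx => ?_)
    by_contra h
    have hx' : F n x = y := hx
    rw [hF, Set.indicator_of_notMem h] at hx'
    exact hy hx'.symm
  have hfin : ∀ n x, F n x ≠ ∞ := by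
    intro n x
    rw [hF]
    by_cases h : x ∈ Metric.ball (0 : Plane) n
    · rw [Set.indicator_of_mem h]
      exact (SimpleFunc.eapprox_lt_top f n x).ne
    · rw [Set.indicator_of_notMem h]
      simp
  have hXi : ∀ i, Measurable fun ω => X ω i := fun i => (measurable_pi_apply i).comp hX.measurable
  have htsum : ∀ x : ℕ → Plane, Tendsto (fun n => ∑' i, F n (x i)) atTop (𝓝 (∑' i, f (x i))) := by
    intro x
    simp_rw [← lintegral_count]
    exact lintegral_tendsto_of_tendsto_of_monotone (fun n => Measurable.of_discrete.aemeasurable)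
      (ae_of_all _ fun i m n hmn => hmono hmn (x i)) (ae_of_all _ fun i => hlim (x i))
  have hL := tendsto_lintegral_expNeg (P := P) (F := fun n ω => ∑' i, F n (X ω i))
    (fun n => Measurable.tsum fun i => (F n).measurable.comp (hXi i))
    (fun ω => htsum (X ω))
  have hint : Tendsto (fun n => ∫⁻ x, (1 - expNeg (F n x))) atTop
      (𝓝 (∫⁻ x, (1 - expNeg (f x)))) := by
    refine lintegral_tendsto_of_tendsto_of_monotone
      (fun n => (measurable_const.sub (measurable_expNeg.comp (F n).measurable)).aemeasurable)
      (ae_of_all _ fun x m n hmn => tsub_le_tsub_left (expNeg_antitone (hmono hmn x)) _)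
      (ae_of_all _ fun x => ?_)
    exact ENNReal.Tendsto.sub tendsto_const_nhds ((continuous_expNeg.tendsto _).comp (hlim x))
      (Or.inl ENNReal.one_ne_top)
  have hR := (continuous_expNeg.tendsto _).comp
    (ENNReal.Tendsto.const_mul hint (Or.inr (ENNReal.ofReal_ne_top (r := lam))))
  refine tendsto_nhds_unique hL (hR.congr fun n => ?_)
  exact (hX.lintegral_expNeg_tsum_simpleFunc hlam (F n) (hsupp n) (hfin n)).symm

end Laplace

/-! ### Independent marks -/

section Marked

variable {Ω : Type*} [MeasurableSpace Ω] {P : Measure Ω} {lam : ℝ} {X : Ω → ℕ → Plane}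
  {M : ℕ → Ω → ℝ≥0∞} {g : Plane → ℝ≥0∞}

/-- By Fubini the locations can be frozen; the remaining mean over independent marks factorizes.
Finitely many points suffice, as the full series is reached by a limit. -/
lemma lintegral_expNeg_sum_marks [IsProbabilityMeasure P] (hX : Measurable X)
    (hM : ∀ i, Measurable (M i)) (hMi : iIndepFun M P)
    (hid : ∀ i, IdentDistrib (M i) (M 0) P P) (hXM : IndepFun X (fun ω i => M i ω) P)
    (hg : Measurable g) (n : ℕ) :
    ∫⁻ ω, expNeg (∑ i ∈ Finset.range n, M i ω * g (X ω i)) ∂P =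
      ∫⁻ ω, ∏ i ∈ Finset.range n, (∫⁻ ω', expNeg (M 0 ω' * g (X ω i)) ∂P) ∂P := by
  have hM' : Measurable fun ω i => M i ω := measurable_pi_lambda _ hM
  let G : (ℕ → Plane) × (ℕ → ℝ≥0∞) → ℝ≥0∞ := fun z =>
    expNeg (∑ i ∈ Finset.range n, z.2 i * g (z.1 i))
  have hG : Measurable G := by
    refine measurable_expNeg.comp (Finset.measurable_fun_sum _ fun i _ => ?_)
    exact ((measurable_pi_apply i).comp measurable_snd).mul
      (hg.comp ((measurable_pi_apply i).comp measurable_fst))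
  have h1 : ∫⁻ ω, expNeg (∑ i ∈ Finset.range n, M i ω * g (X ω i)) ∂P =
      ∫⁻ z, G z ∂(P.map fun ω => (X ω, fun i => M i ω)) :=
    (lintegral_map hG (hX.prodMk hM')).symm
  have := Measure.isProbabilityMeasure_map (μ := P) hX.aemeasurable
  have := Measure.isProbabilityMeasure_map (μ := P) hM'.aemeasurable
  rw [h1, (indepFun_iff_map_prod_eq_prod_map_map hX.aemeasurable hM'.aemeasurable).1 hXM,
    lintegral_prod _ hG.aemeasurable, lintegral_map hG.lintegral_prod_right' hX]
  congr 1 with ω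
  rw [lintegral_map (f := fun m => G (X ω, m)) (hG.comp measurable_prodMk_left) hM']
  simp only [G, expNeg_sum]
  have hmeas : ∀ i, Measurable fun y : ℝ≥0∞ => expNeg (y * g (X ω i)) := fun i =>
    measurable_expNeg.comp (measurable_id.mul_const _)
  have h2 := lintegral_prod_eq_prod_lintegral_of_indepFun (Finset.range n) _
    (hMi.comp (fun i y => expNeg (y * g (X ω i))) hmeas) (fun i => (hmeas i).comp (hM i))
  simp only [Function.comp_def] at h2
  rw [h2]
  refine Finset.prod_congr rfl fun i _ => ?_
  exact ((hid i).comp (hmeas i)).lintegral_eq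

/-- The Laplace functional of a homogeneous Poisson point process with independent and identically
distributed marks. -/
theorem IsHPPP.lintegral_expNeg_tsum_marks [IsProbabilityMeasure P] (hlam : 0 ≤ lam)
    (hX : IsHPPP P lam X) (hM : ∀ i, Measurable (M i)) (hMi : iIndepFun M P)
    (hid : ∀ i, IdentDistrib (M i) (M 0) P P) (hXM : IndepFun X (fun ω i => M i ω) P)
    (hg : Measurable g) :
    ∫⁻ ω, expNeg (∑' i, M i ω * g (X ω i)) ∂P =
      expNeg (ENNReal.ofReal lam * ∫⁻ x, ∫⁻ ω, (1 - expNeg (M 0 ω * g x)) ∂P) := by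
  let φ : Plane → ℝ≥0∞ := fun x => ∫⁻ ω, expNeg (M 0 ω * g x) ∂P
  have hφm : Measurable φ := by
    refine Measurable.lintegral_prod_right' (f := fun z : Plane × Ω => expNeg (M 0 z.2 * g z.1)) ?_
    exact measurable_expNeg.comp
      (((hM 0).comp measurable_snd).mul (hg.comp measurable_fst))
  have hφ1 : ∀ x, φ x ≤ 1 := fun x =>
    (lintegral_mono fun ω => expNeg_le_one _).trans_eq (by simp)
  -- Averaging out the marks leaves the product of φ over the points, which is the unmarked
  -- functional of f = -log φ.
  let f : Plane → ℝ≥0∞ := fun x => (-(ENNReal.log (φ x))).toENNReal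
  have hf : Measurable f := (hφm.ennreal_log.neg).ereal_toENNReal
  have hfφ : ∀ x, expNeg (f x) = φ x := fun x => expNeg_toENNReal_neg_log (hφ1 x)
  have hXi : ∀ i, Measurable fun ω => X ω i := fun i => (measurable_pi_apply i).comp hX.measurable
  have hL := tendsto_lintegral_expNeg (P := P)
    (F := fun n ω => ∑ i ∈ Finset.range n, M i ω * g (X ω i))
    (fun n => Finset.measurable_fun_sum _ fun i _ => (hM i).mul (hg.comp (hXi i)))
    (fun ω => ENNReal.tendsto_nat_tsum _)
  have hR := tendsto_lintegral_expNeg (P := P)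
    (F := fun n ω => ∑ i ∈ Finset.range n, f (X ω i))
    (fun n => Finset.measurable_fun_sum _ fun i _ => hf.comp (hXi i))
    (fun ω => ENNReal.tendsto_nat_tsum _)
  have hLR := tendsto_nhds_unique hL (hR.congr fun n => by
    rw [lintegral_expNeg_sum_marks hX.measurable hM hMi hid hXM hg]
    simp_rw [expNeg_sum, hfφ]
    rfl)
  rw [hLR, hX.lintegral_expNeg_tsum hlam hf]
  simp_rw [hfφ]
  congr 3 with x
  rw [lintegral_sub' (g := fun ω => expNeg (M 0 ω * g x))
    (measurable_expNeg.comp ((hM 0).mul_const _)).aemeasurable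
    (ne_top_of_le_ne_top ENNReal.one_ne_top (hφ1 x)) (ae_of_all _ fun ω => expNeg_le_one _)]
  simp [φ]

end Marked

/-! ### Exponential moments and the path-loss integral -/

section PathLoss

lemma expMeasure_one_Iic {y : ℝ} (hy : 0 ≤ y) :
    expMeasure 1 (Set.Iic y) = 1 - expNeg (ENNReal.ofReal y) := by
  have := isProbabilityMeasure_expMeasure one_pos
  rw [← ofReal_cdf, cdf_expMeasure_eq one_pos, if_pos hy, expNeg_ofReal hy,
    ENNReal.ofReal_sub _ (Real.exp_nonneg _), ENNReal.ofReal_one, one_mul]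

lemma expMeasure_one_Ioi {y : ℝ} (hy : 0 ≤ y) :
    expMeasure 1 (Set.Ioi y) = expNeg (ENNReal.ofReal y) := by
  have := isProbabilityMeasure_expMeasure one_pos
  rw [← Set.compl_Iic, prob_compl_eq_one_sub measurableSet_Iic, expMeasure_one_Iic hy,
    ENNReal.sub_sub_cancel ENNReal.one_ne_top (expNeg_le_one _)]

lemma ae_pos_expMeasure_one : ∀ᵐ v ∂(expMeasure 1), 0 < v := by
  rw [ae_iff]
  simp only [not_lt]
  exact (expMeasure_one_Iic le_rfl).trans (by simp [expNeg_zero])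

lemma lintegral_expMeasure_one {f : ℝ → ℝ≥0∞} (hf : Measurable f) :
    ∫⁻ v, f v ∂(expMeasure 1) = ∫⁻ v in Set.Ioi 0, ENNReal.ofReal (Real.exp (-v)) * f v := by
  have h : expMeasure 1 = volume.withDensity (exponentialPDF 1) := rfl
  have hm : Measurable (exponentialPDF 1) := (measurable_exponentialPDFReal 1).ennreal_ofReal
  rw [h, lintegral_withDensity_eq_lintegral_mul _ hm hf,
    ← setLIntegral_eq_of_support_subset (s := Set.Ici 0), setLIntegral_congr Ioi_ae_eq_Ici.symm]
  · refine setLIntegral_congr_fun measurableSet_Ioi fun v hv => ?_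
    simp [exponentialPDF_of_nonneg (le_of_lt hv)]
  · intro v hv
    by_contra h
    exact hv (by simp [exponentialPDF_of_neg (not_le.1 h)])

/-- The moments of the standard exponential distribution. -/
lemma lintegral_rpow_expMeasure_one {d : ℝ} (hd : -1 < d) :
    ∫⁻ v, ENNReal.ofReal (v ^ d) ∂(expMeasure 1) = ENNReal.ofReal (Real.Gamma (1 + d)) := by
  rw [lintegral_expMeasure_one (by fun_prop), Real.Gamma_eq_integral (by linarith),
    ofReal_integral_eq_lintegral_ofReal (Real.GammaIntegral_convergent (by linarith))]
  · refine setLIntegral_congr_fun measurableSet_Ioi fun v _ => ?_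
    rw [← ENNReal.ofReal_mul (Real.exp_nonneg _), add_sub_cancel_left]
  · filter_upwards [ae_restrict_mem measurableSet_Ioi] with v hv
    have : (0 : ℝ) < v := hv
    positivity

lemma volume_setOf_le_mul_norm_rpow {α a v : ℝ} (hα : 0 < α) (ha : 0 < a) (hv : 0 < v) :
    volume {x : Plane | v ≤ a * ‖x‖ ^ (-α)} =
      ENNReal.ofReal (Real.pi * a ^ (2 / α)) * ENNReal.ofReal (v ^ (-(2 / α))) := by
  -- The origin is removed because `0 ^ (-α)` is 0 here, so it fails the inequality; this costs only
  -- a null set.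
  have h : {x : Plane | v ≤ a * ‖x‖ ^ (-α)} = Metric.closedBall 0 ((a / v) ^ α⁻¹) \ {0} := by
    ext x
    rcases eq_or_ne x 0 with rfl | hx
    · simp [Real.zero_rpow (neg_ne_zero.2 hα.ne'), hv]
    · have hx' : 0 < ‖x‖ := norm_pos_iff.2 hx
      simp only [Set.mem_ofPred_eq, Set.mem_sdiff, Metric.mem_closedBall, dist_zero_right,
        Set.mem_singleton_iff, hx, not_false_eq_true, and_true]
      rw [Real.le_rpow_inv_iff_of_pos hx'.le (by positivity) hα, Real.rpow_neg hx'.le,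
        le_div_iff₀ hv, ← div_eq_mul_inv, le_div_iff₀ (by positivity), mul_comm]
  rw [h, measure_sdiff_null (by simp), EuclideanSpace.volume_closedBall_fin_two,
    ← ENNReal.ofReal_pow (by positivity), ← ENNReal.ofReal_mul (by positivity),
    ← ENNReal.ofReal_mul (by positivity), ← Real.rpow_natCast, ← Real.rpow_mul (by positivity),
    Real.div_rpow ha.le hv.le, Real.rpow_neg hv.le]
  congr 1
  rw [show α⁻¹ * ((2 : ℕ) : ℝ) = 2 / α by push_cast; ring]
  ring

/-- Since 1 - exp(-y) = P(E ≤ y) for a standard exponential E, Tonelli turns the integral into the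
mean area of the disc ‖x‖ ≤ (a/E)^(1/α), namely π a^(2/α) E[E^(-2/α)]. That moment is Γ(1 - 2/α),
finite because α > 2. -/
lemma lintegral_one_sub_expNeg_mul_norm_rpow {α a : ℝ} (hα : 2 < α) (ha : 0 ≤ a) :
    ∫⁻ x : Plane, (1 - expNeg (ENNReal.ofReal (a * ‖x‖ ^ (-α)))) =
      ENNReal.ofReal (Real.pi * Real.Gamma (1 - 2 / α)) * ENNReal.ofReal (a ^ (2 / α)) := by
  have hα0 : 0 < α := by linarith
  have hα1 : 2 / α < 1 := by rwa [div_lt_one hα0]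
  rcases ha.eq_or_lt with rfl | ha
  · rw [Real.zero_rpow (by positivity)]
    simp [expNeg_zero]
  have := isProbabilityMeasure_expMeasure one_pos
  let S : Set (Plane × ℝ) := {z | z.2 ≤ a * ‖z.1‖ ^ (-α)}
  have hS : MeasurableSet S := measurableSet_le measurable_snd (by fun_prop)
  have h1 : ∫⁻ x : Plane, (1 - expNeg (ENNReal.ofReal (a * ‖x‖ ^ (-α)))) =
      (volume.prod (expMeasure 1)) S := by
    rw [Measure.prod_apply hS]
    congr 1 with x
    rw [← expMeasure_one_Iic (by positivity)]
    rfl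
  have h2 : (volume.prod (expMeasure 1)) S =
      ∫⁻ v, ENNReal.ofReal (Real.pi * a ^ (2 / α)) * ENNReal.ofReal (v ^ (-(2 / α)))
        ∂(expMeasure 1) := by
    rw [Measure.prod_apply_symm hS]
    refine lintegral_congr_ae ?_
    filter_upwards [ae_pos_expMeasure_one] with v hv
    rw [← volume_setOf_le_mul_norm_rpow hα0 ha hv]
    rfl
  rw [h1, h2, lintegral_const_mul _ (by fun_prop), lintegral_rpow_expMeasure_one (by linarith),
    ← ENNReal.ofReal_mul (by positivity), ← sub_eq_add_neg,
    ← ENNReal.ofReal_mul (mul_nonneg Real.pi_pos.le (Real.Gamma_nonneg_of_nonneg (by linarith)))]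
  congr 1
  ring

end PathLoss

/-! ### Grouping independent σ-algebras; exponential tails -/

section Independence

variable {Ω ι κ : Type*} [mΩ : MeasurableSpace Ω] {P : Measure Ω}

/-- Disjoint groups of independent σ-algebras generate independent σ-algebras. -/
lemma iIndep_biSup_of_disjoint {m : ι → MeasurableSpace Ω} (hm : ∀ i, m i ≤ mΩ)
    (h : iIndep m P) {S : κ → Set ι} (hS : Pairwise fun j k => Disjoint (S j) (S k)) :
    iIndep (fun k => ⨆ i ∈ S k, m i) P := by
  classical
  have := h.isProbabilityMeasure
  rw [iIndep_iff]
  intro s f hf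
  induction s using Finset.induction_on with
  | empty => simp
  | insert a s ha ih =>
    have hs : ∀ k ∈ s, MeasurableSet[⨆ i ∈ S k, m i] (f k) := fun k hk =>
      hf k (Finset.mem_insert_of_mem hk)
    have hdisj : Disjoint (S a) (⋃ k ∈ s, S k) := by
      simp only [Set.disjoint_iUnion_right]
      rintro k hk
      exact hS (by rintro rfl; exact ha hk)
    have hI : MeasurableSet[⨆ i ∈ ⋃ k ∈ s, S k, m i] (⋂ k ∈ s, f k) := by
      refine Finset.measurableSet_biInter (m := ⨆ i ∈ ⋃ k ∈ s, S k, m i) s fun k hk => ?_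
      exact (biSup_mono (Set.subset_biUnion_of_mem (u := S) hk) : (⨆ i ∈ S k, m i) ≤ _) _ (hs k hk)
    rw [Finset.set_biInter_insert, Finset.prod_insert ha, ← ih hs]
    exact (Indep_iff _ _ _).1 (indep_iSup_of_disjoint hm h hdisj) _ _
      (hf a (Finset.mem_insert_self a s)) hI

/-- A standard exponential variable exceeds an independent extended nonnegative variable `Y` with
probability `E[exp (-Y)]`. -/
lemma measure_lt_ofReal_of_hasLaw_expMeasure [IsProbabilityMeasure P] {h : Ω → ℝ} {Y : Ω → ℝ≥0∞}
    (hh : HasLaw h (expMeasure 1) P) (hY : Measurable Y) (hind : IndepFun h Y P) :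
    P {ω | Y ω < ENNReal.ofReal (h ω)} = ∫⁻ ω, expNeg (Y ω) ∂P := by
  have := isProbabilityMeasure_expMeasure one_pos
  have := Measure.isProbabilityMeasure_map (μ := P) hY.aemeasurable
  let S : Set (ℝ × ℝ≥0∞) := {z | z.2 < ENNReal.ofReal z.1}
  have hS : MeasurableSet S := measurableSet_lt measurable_snd (by fun_prop)
  have h1 : P {ω | Y ω < ENNReal.ofReal (h ω)} = P.map (fun ω => (h ω, Y ω)) S :=
    (Measure.map_apply_of_aemeasurable (hh.aemeasurable.prodMk hY.aemeasurable) hS).symm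
  rw [h1, (indepFun_iff_map_prod_eq_prod_map_map hh.aemeasurable hY.aemeasurable).1 hind,
    hh.map_eq, Measure.prod_apply_symm hS, ← lintegral_map measurable_expNeg hY]
  congr 1 with y
  induction y using ENNReal.recTopCoe with
  | top => simp [S, expNeg_top, Set.preimage]
  | coe y =>
    rw [← ENNReal.ofReal_coe_nnreal, ← expMeasure_one_Ioi y.coe_nonneg]
    congr 1 with v
    simp [S]

end Independence

/-! ### Which elementary random elements determine which quantities -/

namespace Network

variable {Ω : Type*}

/-- The σ-algebra generated by a set of elementary random elements. -/
noncomputable def sigma (N : Network Ω) (S : Set Source) : MeasurableSpace Ω :=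
  ⨆ s ∈ S, MeasurableSpace.comap (N.element s) inferInstance

lemma measurable_sigma (N : Network Ω) {S : Set Source} {s : Source} (hs : s ∈ S) :
    Measurable[N.sigma S] (N.element s) :=
  Measurable.of_comap_le (le_biSup (fun s => MeasurableSpace.comap (N.element s) inferInstance) hs)

lemma sigma_mono (N : Network Ω) {S T : Set Source} (h : S ⊆ T) : N.sigma S ≤ N.sigma T :=
  biSup_mono h

section

variable [mΩ : MeasurableSpace Ω] {N : Network Ω} {par : Params} {P : Measure Ω}

lemma IsMeanFieldTSA.sigma_le (hN : N.IsMeanFieldTSA par P) (S : Set Source) : N.sigma S ≤ mΩ :=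
  iSup₂_le fun s _ => (hN.measurable s).comap_le

lemma IsMeanFieldTSA.iIndep_sigma (hN : N.IsMeanFieldTSA par P) {κ : Type*} {S : κ → Set Source}
    (hS : Pairwise fun j k => Disjoint (S j) (S k)) : iIndep (fun k => N.sigma (S k)) P :=
  iIndep_biSup_of_disjoint (fun s => (hN.measurable s).comap_le)
    ((iIndepFun_iff_iIndep _ _ _).1 hN.indep) hS

lemma IsMeanFieldTSA.indep_sigma (hN : N.IsMeanFieldTSA par P) {S T : Set Source} (hST : Disjoint S T) :
    Indep (N.sigma S) (N.sigma T) P :=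
  indep_iSup_of_disjoint (fun s => (hN.measurable s).comap_le)
    ((iIndepFun_iff_iIndep _ _ _).1 hN.indep) hST

end

attribute [irreducible] sigma

/-- The elementary random elements that determine the activity of interferer `i` in slot `t`. -/
def activitySources (t i : ℕ) : Set Source := {.coin t i, .interfererAge t i}

/-- The elementary random elements that determine the power emitted by interferer `i` in slot `t`,
as seen from the origin up to the path loss. -/
def markSources (t i : ℕ) : Set Source := {.fading t i, .coin t i, .interfererAge t i}

/-- The elementary random elements that determine the interference in slot `t`. -/
def interferenceSources (t : ℕ) : Set Source := {.position t} ∪ ⋃ i, markSources t i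

/-- The elementary random elements that determine the ratio of signal to interference plus noise
in slot `t`. -/
def sinrSources (t : ℕ) : Set Source := {.ownFading t} ∪ interferenceSources t

/-- The elementary random elements that determine the age of the typical link in slot `t`. -/
def ageSources (t : ℕ) : Set Source :=
  {.initialAge} ∪ ⋃ u < t, ({.ownCoin u} ∪ sinrSources u)

open Classical in
/-- The fading of interferer `i` when it transmits in slot `t`, and zero otherwise. -/
noncomputable def mark (N : Network Ω) (par : Params) (t i : ℕ) (ω : Ω) : ℝ≥0∞ :=
  if N.Transmits par t i ω then ENNReal.ofReal (N.fading t i ω) else 0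

lemma interference_eq_tsum_mark (N : Network Ω) (par : Params) (t : ℕ) (ω : Ω) :
    N.interference par t ω =
      ∑' i, N.mark par t i ω * ENNReal.ofReal (‖N.position t ω i‖ ^ (-par.α)) := by
  unfold interference mark
  congr 1 with i
  split_ifs
  · rw [ENNReal.ofReal_mul' (by positivity)]
  · simp

lemma measurableSet_transmits (N : Network Ω) (par : Params) (t i : ℕ) :
    MeasurableSet[N.sigma (activitySources t i)] {ω | N.Transmits par t i ω} := by
  let _ := N.sigma (activitySources t i)
  have h1 : Measurable (N.coin t i) :=
    N.measurable_sigma (s := .coin t i) (by simp [activitySources])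
  have h2 : Measurable (N.interfererAge t i) :=
    N.measurable_sigma (s := .interfererAge t i) (by simp [activitySources])
  exact (h2 (measurableSet_Ioi (a := par.A))).inter (h1 (measurableSet_singleton true))

lemma measurable_mark_sigma (N : Network Ω) (par : Params) (t i : ℕ) :
    Measurable[N.sigma (markSources t i)] (N.mark par t i) := by
  have hT := N.sigma_mono (T := markSources t i) (S := activitySources t i)
    (by simp [activitySources, markSources]) _ (N.measurableSet_transmits par t i)
  let _ := N.sigma (markSources t i)
  have h1 : Measurable (N.fading t i) :=
    N.measurable_sigma (s := .fading t i) (by simp [markSources])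
  exact Measurable.ite hT h1.ennreal_ofReal measurable_const

lemma measurable_interference_sigma (N : Network Ω) (par : Params) (t : ℕ) :
    Measurable[N.sigma (interferenceSources t)] (N.interference par t) := by
  have hm : ∀ i, Measurable[N.sigma (interferenceSources t)] (N.mark par t i) := fun i =>
    (N.measurable_mark_sigma par t i).mono (N.sigma_mono
      ((Set.subset_iUnion (markSources t) i).trans Set.subset_union_right)) le_rfl
  let _ := N.sigma (interferenceSources t)
  have h1 : Measurable (N.position t) :=
    N.measurable_sigma (s := .position t) (by simp [interferenceSources])
  have h2 : N.interference par t = fun ω =>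
      ∑' i, N.mark par t i ω * ENNReal.ofReal (‖N.position t ω i‖ ^ (-par.α)) :=
    funext (N.interference_eq_tsum_mark par t)
  rw [h2]
  refine Measurable.tsum fun i => (hm i).mul ?_
  exact ((((measurable_pi_apply i).comp h1).norm).pow_const _).ennreal_ofReal

lemma measurable_sinr_sigma (N : Network Ω) (par : Params) (t : ℕ) :
    Measurable[N.sigma (sinrSources t)] (N.sinr par t) := by
  have hI := (N.measurable_interference_sigma par t).mono
    (N.sigma_mono (T := sinrSources t) Set.subset_union_right) le_rfl
  let _ := N.sigma (sinrSources t)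
  have h1 : Measurable (N.ownFading t) :=
    N.measurable_sigma (s := .ownFading t) (by simp [sinrSources])
  exact ((h1.mul_const _).ennreal_ofReal).div (hI.add_const _)

/-- The age in slot t uses only coins and SINRs of slots u < t, which is what makes it independent
of the coin and SINR of its own slot. -/
lemma measurable_age_sigma (N : Network Ω) (par : Params) (t : ℕ) :
    Measurable[N.sigma (ageSources t)] (N.age par t) := by
  induction t with
  | zero =>
    exact N.measurable_sigma (s := .initialAge) (by simp [ageSources])
  | succ t ih =>
    have hsub : ageSources t ⊆ ageSources (t + 1) :=
      Set.union_subset_union_right _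
        (Set.biUnion_subset_biUnion_left fun u (hu : u < t) => hu.trans (Nat.lt_succ_self t))
    have hsub' : {Source.ownCoin t} ∪ sinrSources t ⊆ ageSources (t + 1) :=
      (Set.subset_biUnion_of_mem (u := fun u => {Source.ownCoin u} ∪ sinrSources u)
        (x := t) (s := {u | u < t + 1}) (Nat.lt_succ_self t)).trans Set.subset_union_right
    have h1 := ih.mono (N.sigma_mono hsub) le_rfl
    have h2 := (N.measurable_sinr_sigma par t).mono
      (N.sigma_mono (Set.subset_union_right.trans hsub')) le_rfl
    let _ := N.sigma (ageSources (t + 1))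
    have h3 : Measurable (N.ownCoin t) :=
      N.measurable_sigma (s := .ownCoin t) (hsub' (by simp))
    have hset : MeasurableSet {ω | par.A < N.age par t ω ∧ N.ownCoin t ω = true ∧
        ENNReal.ofReal par.θ < N.sinr par t ω} :=
      (h1 (measurableSet_Ioi (a := par.A))).inter
        ((h3 (measurableSet_singleton true)).inter (h2 measurableSet_Ioi))
    exact Measurable.ite hset measurable_const (h1.add_const 1)

/-! ### Law of the marks and Laplace transform of the interference -/

namespace IsMeanFieldTSA

variable [mΩ : MeasurableSpace Ω] {N : Network Ω} {par : Params} {P : Measure Ω}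

lemma indepFun_of_disjoint (hN : N.IsMeanFieldTSA par P) {S T : Set Source}
    (hST : Disjoint S T) {β γ : Type*} [MeasurableSpace β] [MeasurableSpace γ] {f : Ω → β}
    {g : Ω → γ} (hf : Measurable[N.sigma S] f) (hg : Measurable[N.sigma T] g) :
    IndepFun f g P :=
  indep_of_indep_of_le (hN.indep_sigma hST) hf.comap_le hg.comap_le

lemma measure_inter_of_disjoint (hN : N.IsMeanFieldTSA par P) {S T : Set Source}
    (hST : Disjoint S T) {a b : Set Ω} (ha : MeasurableSet[N.sigma S] a)
    (hb : MeasurableSet[N.sigma T] b) : P (a ∩ b) = P a * P b :=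
  (Indep_iff _ _ _).1 (hN.indep_sigma hST) _ _ ha hb

lemma lintegral_mul_of_disjoint (hN : N.IsMeanFieldTSA par P) {S T : Set Source}
    (hST : Disjoint S T) {f g : Ω → ℝ≥0∞} (hf : Measurable[N.sigma S] f)
    (hg : Measurable[N.sigma T] g) :
    ∫⁻ ω, f ω * g ω ∂P = (∫⁻ ω, f ω ∂P) * ∫⁻ ω, g ω ∂P :=
  lintegral_mul_eq_lintegral_mul_lintegral_of_independent_measurableSpace (hN.sigma_le S)
    (hN.sigma_le T) (hN.indep_sigma hST) hf hg

lemma measure_transmits (hN : N.IsMeanFieldTSA par P) (t i : ℕ) :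
    P {ω | N.Transmits par t i ω} =
      P {ω | par.A < N.age par 0 ω} * ENNReal.ofReal par.η := by
  have h1 : Measurable[N.sigma {.coin t i}] (N.coin t i) :=
    N.measurable_sigma (s := .coin t i) rfl
  have h2 : Measurable[N.sigma {.interfererAge t i}] (N.interfererAge t i) :=
    N.measurable_sigma (s := .interfererAge t i) rfl
  have h3 := ((hN.symmetric t i).trans (hN.stationary t)).measure_mem_eq
    (measurableSet_Ioi (a := par.A))
  rw [← hN.coin_law t i]
  refine (hN.measure_inter_of_disjoint (by simp) (h2 (measurableSet_Ioi (a := par.A)))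
    (h1 (measurableSet_singleton true))).trans ?_
  congr 1

/-- A mark is a mixture: exponential with the activity probability, an atom at 0 otherwise. The
right side is free of t and i, so all marks share one law. -/
lemma lintegral_comp_mark [IsProbabilityMeasure P] (hN : N.IsMeanFieldTSA par P) (t i : ℕ)
    {F : ℝ≥0∞ → ℝ≥0∞} (hF : Measurable F) :
    ∫⁻ ω, F (N.mark par t i ω) ∂P =
      P {ω | par.A < N.age par 0 ω} * ENNReal.ofReal par.η *
        (∫⁻ v, F (ENNReal.ofReal v) ∂(expMeasure 1)) +
      (1 - P {ω | par.A < N.age par 0 ω} * ENNReal.ofReal par.η) * F 0 := by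
  obtain ⟨T, hTdef⟩ : ∃ T : Set Ω, T = {ω | N.Transmits par t i ω} := ⟨_, rfl⟩
  have hTs : MeasurableSet[N.sigma (activitySources t i)] T :=
    hTdef ▸ N.measurableSet_transmits par t i
  have hT : MeasurableSet T := hN.sigma_le _ _ hTs
  have hfs : Measurable[N.sigma {.fading t i}] (N.fading t i) :=
    N.measurable_sigma (s := .fading t i) rfl
  have h1 : ∀ ω, F (N.mark par t i ω) =
      T.indicator 1 ω * F (ENNReal.ofReal (N.fading t i ω)) + Tᶜ.indicator (fun _ => F 0) ω := by
    intro ω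
    by_cases h : N.Transmits par t i ω
    · have : ω ∈ T := hTdef ▸ h
      simp [mark, h, this]
    · have : ω ∉ T := hTdef ▸ h
      simp [mark, h, this]
  have hi : Measurable[N.sigma (activitySources t i)] (T.indicator (1 : Ω → ℝ≥0∞)) :=
    (measurable_const (a := (1 : ℝ≥0∞))).indicator hTs
  have hFf : Measurable[N.sigma {.fading t i}] fun ω => F (ENNReal.ofReal (N.fading t i ω)) :=
    (hF.comp ENNReal.measurable_ofReal).comp hfs
  have h2 : ∫⁻ ω, T.indicator 1 ω * F (ENNReal.ofReal (N.fading t i ω)) ∂P =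
      (∫⁻ ω, T.indicator 1 ω ∂P) * ∫⁻ ω, F (ENNReal.ofReal (N.fading t i ω)) ∂P :=
    hN.lintegral_mul_of_disjoint (S := activitySources t i) (T := {.fading t i})
      (by simp [activitySources]) hi hFf
  have h3 : ∫⁻ ω, F (ENNReal.ofReal (N.fading t i ω)) ∂P =
      ∫⁻ v, F (ENNReal.ofReal v) ∂(expMeasure 1) :=
    (hN.fading_law t i).lintegral_comp (hF.comp ENNReal.measurable_ofReal).aemeasurable
  simp_rw [h1]
  rw [lintegral_add_right _ (measurable_const.indicator hT.compl),
    lintegral_indicator_const hT.compl, prob_compl_eq_one_sub hT, h2, h3,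
    lintegral_indicator_one hT, hTdef, hN.measure_transmits, mul_comm (F 0)]

lemma measurable_mark (hN : N.IsMeanFieldTSA par P) (t i : ℕ) : Measurable (N.mark par t i) :=
  (N.measurable_mark_sigma par t i).mono (hN.sigma_le _) le_rfl

lemma identDistrib_mark [IsProbabilityMeasure P] (hN : N.IsMeanFieldTSA par P) (t i j : ℕ) :
    IdentDistrib (N.mark par t i) (N.mark par t j) P P := by
  refine ⟨(hN.measurable_mark t i).aemeasurable, (hN.measurable_mark t j).aemeasurable, ?_⟩
  refine Measure.ext_of_lintegral _ fun F hF => ?_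
  rw [lintegral_map hF (hN.measurable_mark t i), lintegral_map hF (hN.measurable_mark t j),
    hN.lintegral_comp_mark t i hF, hN.lintegral_comp_mark t j hF]

lemma iIndepFun_mark (hN : N.IsMeanFieldTSA par P) (t : ℕ) : iIndepFun (N.mark par t) P := by
  rw [iIndepFun_iff_iIndep]
  refine iIndep_of_iIndep_of_le (hN.iIndep_sigma (S := markSources t) fun i j hij => ?_)
    fun i => (N.measurable_mark_sigma par t i).comap_le
  simp [markSources, hij.symm]

lemma indepFun_position_mark (hN : N.IsMeanFieldTSA par P) (t : ℕ) :
    IndepFun (N.position t) (fun ω i => N.mark par t i ω) P := by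
  refine hN.indepFun_of_disjoint (S := {.position t}) (T := ⋃ i, markSources t i)
    (by simp [markSources]) (N.measurable_sigma (s := .position t) rfl) ?_
  let _ := N.sigma (⋃ i, markSources t i)
  exact measurable_pi_lambda _ fun i => (N.measurable_mark_sigma par t i).mono
    (N.sigma_mono (Set.subset_iUnion (markSources t) i)) le_rfl

/-- The Laplace transform of the interference. -/
lemma lintegral_expNeg_interference [IsProbabilityMeasure P] (hpar : par.Admissible)
    (hN : N.IsMeanFieldTSA par P) (t : ℕ) {s : ℝ} (hs : 0 ≤ s) :
    ∫⁻ ω, expNeg (ENNReal.ofReal s * N.interference par t ω) ∂P =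
      expNeg (P {ω | par.A < N.age par 0 ω} * ENNReal.ofReal (par.lam * par.η * (Real.pi *
        s ^ (2 / par.α) * Real.Gamma (1 - 2 / par.α) * Real.Gamma (1 + 2 / par.α)))) := by
  have hα := hpar.two_lt_α
  have hα0 : 0 < par.α := by linarith
  have hα1 : 2 / par.α < 1 := by rwa [div_lt_one hα0]
  have hδ : 0 < 2 / par.α := by positivity
  have hΓ1 : 0 ≤ Real.Gamma (1 - 2 / par.α) := Real.Gamma_nonneg_of_nonneg (by linarith)
  have hΓ2 : 0 ≤ Real.Gamma (1 + 2 / par.α) := Real.Gamma_nonneg_of_nonneg (by linarith)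
  let g : Plane → ℝ≥0∞ := fun x => ENNReal.ofReal (s * ‖x‖ ^ (-par.α))
  have hg : Measurable g := by fun_prop
  have h1 : ∀ ω, ENNReal.ofReal s * N.interference par t ω =
      ∑' i, N.mark par t i ω * g (N.position t ω i) := by
    intro ω
    rw [interference_eq_tsum_mark, ← ENNReal.tsum_mul_left]
    congr 1 with i
    simp only [g]
    rw [ENNReal.ofReal_mul hs]
    ring
  simp_rw [h1]
  rw [(hN.position_law t).lintegral_expNeg_tsum_marks hpar.lam_pos.le (hN.measurable_mark t)
    (hN.iIndepFun_mark t) (fun i => hN.identDistrib_mark t i 0) (hN.indepFun_position_mark t) hg]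
  congr 1
  let F : ℝ≥0∞ → ℝ≥0∞ := fun y => ∫⁻ x, (1 - expNeg (y * g x))
  have hFm : Measurable fun z : ℝ≥0∞ × Plane => 1 - expNeg (z.1 * g z.2) :=
    measurable_const.sub
      (measurable_expNeg.comp (measurable_fst.mul (hg.comp measurable_snd)))
  have hF : Measurable F := hFm.lintegral_prod_right'
  have hswap : ∫⁻ x, ∫⁻ ω, (1 - expNeg (N.mark par t 0 ω * g x)) ∂P =
      ∫⁻ ω, F (N.mark par t 0 ω) ∂P :=
    lintegral_lintegral_swap ((hFm.comp
      (((hN.measurable_mark t 0).comp measurable_snd).prodMk measurable_fst)).aemeasurable)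
  -- Silent interferers contribute nothing, so the activity probability enters as a mere factor in
  -- the exponent.
  have hF0 : F 0 = 0 := by simp [F, expNeg_zero]
  -- The plane integral scales like v^(2/α), and the mean of v^(2/α) over the fading is the second
  -- Gamma factor of c.
  have hFv : ∫⁻ v, F (ENNReal.ofReal v) ∂(expMeasure 1) =
      ENNReal.ofReal (Real.pi * Real.Gamma (1 - 2 / par.α) * s ^ (2 / par.α)) *
        ENNReal.ofReal (Real.Gamma (1 + 2 / par.α)) := by
    rw [← lintegral_rpow_expMeasure_one (by linarith), ← lintegral_const_mul _ (by fun_prop)]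
    refine lintegral_congr_ae ?_
    filter_upwards [ae_pos_expMeasure_one] with v hv
    simp only [F, g]
    simp_rw [← ENNReal.ofReal_mul hv.le, ← mul_assoc]
    rw [lintegral_one_sub_expNeg_mul_norm_rpow hα (by positivity), Real.mul_rpow hv.le hs,
      ← ENNReal.ofReal_mul (by positivity), ← ENNReal.ofReal_mul (by positivity)]
    congr 1
    ring
  rw [hswap, hN.lintegral_comp_mark t 0 hF, hF0, hFv, mul_zero, add_zero,
    ← ENNReal.ofReal_mul (by positivity), mul_assoc, mul_left_comm,
    ← ENNReal.ofReal_mul hpar.η_pos.le, ← ENNReal.ofReal_mul hpar.lam_pos.le]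
  congr 2
  ring

end IsMeanFieldTSA

end Network

/-! ### Success probability and the steady-state age -/

namespace Network

variable {Ω : Type*}

/-- Clears the denominator and the path loss of the link. For infinite interference both sides are
false. -/
lemma lt_sinr_iff (N : Network Ω) {par : Params} (hpar : par.Admissible) (t : ℕ) (ω : Ω) :
    ENNReal.ofReal par.θ < N.sinr par t ω ↔
      ENNReal.ofReal (par.θ * par.r ^ par.α) * (N.interference par t ω + ENNReal.ofReal par.ρ⁻¹) <
        ENNReal.ofReal (N.ownFading t ω) := by
  have hr : 0 < par.r ^ par.α := Real.rpow_pos_of_pos hpar.r_pos _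
  have hρ : ENNReal.ofReal par.ρ⁻¹ ≠ 0 := by simpa using hpar.ρ_pos
  have hθ : ENNReal.ofReal par.θ ≠ 0 := by simpa using hpar.θ_pos
  have h1 : ENNReal.ofReal (N.ownFading t ω) =
      ENNReal.ofReal (par.r ^ par.α) * ENNReal.ofReal (N.ownFading t ω * par.r ^ (-par.α)) := by
    rw [← ENNReal.ofReal_mul hr.le, Real.rpow_neg hpar.r_pos.le]
    congr 1
    field_simp
  rw [sinr, ENNReal.lt_div_iff_mul_lt (Or.inl (by simp [hρ])) (Or.inr hθ), h1, mul_comm par.θ,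
    ENNReal.ofReal_mul hr.le, mul_assoc,
    ENNReal.mul_lt_mul_iff_right (by simpa using hr) ENNReal.ofReal_ne_top]

namespace IsMeanFieldTSA

variable [MeasurableSpace Ω] {N : Network Ω} {par : Params} {P : Measure Ω}

/-- The success probability in terms of the probability that the age exceeds the threshold. -/
lemma successProb_eq_exp [IsProbabilityMeasure P] (hpar : par.Admissible)
    (hN : N.IsMeanFieldTSA par P) (t : ℕ) :
    N.successProb par P t =
      Real.exp (-(P.real {ω | par.A < N.age par 0 ω} * (par.lam * par.c * par.η * par.r ^ 2))
        - par.θ * par.r ^ par.α / par.ρ) := by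
  have hr := hpar.r_pos
  have hθ := hpar.θ_pos
  have hη := hpar.η_pos
  have hρ := hpar.ρ_pos
  have hlam := hpar.lam_pos
  have hα0 : 0 < par.α := by linarith [hpar.two_lt_α]
  have hα1 : 2 / par.α < 1 := by rw [div_lt_one hα0]; exact hpar.two_lt_α
  have hδ : 0 < 2 / par.α := by positivity
  have hΓ1 : 0 ≤ Real.Gamma (1 - 2 / par.α) := Real.Gamma_nonneg_of_nonneg (by linarith)
  have hΓ2 : 0 ≤ Real.Gamma (1 + 2 / par.α) := Real.Gamma_nonneg_of_nonneg (by linarith)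
  set s : ℝ := par.θ * par.r ^ par.α with hs
  have hs0 : 0 ≤ s := by positivity
  -- The exponent 2/α turns r^α into the factor r² of the contention term.
  have hsδ : s ^ (2 / par.α) = par.θ ^ (2 / par.α) * par.r ^ 2 := by
    rw [hs, Real.mul_rpow hθ.le (by positivity), ← Real.rpow_mul hr.le, mul_div_cancel₀ _ hα0.ne',
      Real.rpow_two]
  have hIs := N.measurable_interference_sigma par t
  have hI : Measurable (N.interference par t) := hIs.mono (hN.sigma_le _) le_rfl
  let φ : ℝ≥0∞ → ℝ≥0∞ := fun y => ENNReal.ofReal s * (y + ENNReal.ofReal par.ρ⁻¹)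
  have hφ : Measurable φ := (measurable_id.add_const _).const_mul _
  have hind : IndepFun (N.ownFading t) (N.interference par t) P :=
    hN.indepFun_of_disjoint (S := {.ownFading t}) (T := interferenceSources t)
      (by simp [interferenceSources, markSources])
      (N.measurable_sigma (s := .ownFading t) rfl) hIs
  have h1 : P {ω | ENNReal.ofReal par.θ < N.sinr par t ω} =
      ∫⁻ ω, expNeg (φ (N.interference par t ω)) ∂P := by
    simp_rw [N.lt_sinr_iff hpar t]
    exact measure_lt_ofReal_of_hasLaw_expMeasure (hN.ownFading_law t) (hφ.comp hI)
      (hind.comp measurable_id hφ)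
  have h2 : ∀ y, expNeg (φ y) = expNeg (ENNReal.ofReal s * y) *
      ENNReal.ofReal (Real.exp (-(s / par.ρ))) := by
    intro y
    rw [← expNeg_ofReal (by positivity), ← expNeg_add, div_eq_mul_inv, ENNReal.ofReal_mul hs0,
      ← mul_add]
  have hK : 0 ≤ par.lam * par.c * par.η * par.r ^ 2 := by
    unfold Params.c
    positivity
  rw [successProb, measureReal_def, h1]
  simp_rw [h2]
  rw [lintegral_mul_const (f := fun ω => expNeg (ENNReal.ofReal s * N.interference par t ω)) _
      (measurable_expNeg.comp (hI.const_mul _)),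
    hN.lintegral_expNeg_interference hpar t hs0, hsδ,
    show par.lam * par.η * (Real.pi * (par.θ ^ (2 / par.α) * par.r ^ 2) *
      Real.Gamma (1 - 2 / par.α) * Real.Gamma (1 + 2 / par.α)) =
      par.lam * par.c * par.η * par.r ^ 2 by unfold Params.c; ring,
    ← ENNReal.ofReal_toReal (measure_ne_top P {ω | par.A < N.age par 0 ω}), ← measureReal_def,
    ← ENNReal.ofReal_mul measureReal_nonneg, expNeg_ofReal (mul_nonneg measureReal_nonneg hK),
    ← ENNReal.ofReal_mul (Real.exp_nonneg _), ENNReal.toReal_ofReal (by positivity),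
    ← Real.exp_add, sub_eq_add_neg]

lemma measurable_age (hN : N.IsMeanFieldTSA par P) (t : ℕ) : Measurable (N.age par t) :=
  (N.measurable_age_sigma par t).mono (hN.sigma_le _) le_rfl

lemma measureReal_age_eq (hN : N.IsMeanFieldTSA par P) (t k : ℕ) :
    P.real {ω | N.age par t ω = k} = P.real {ω | N.age par 0 ω = k} :=
  congrArg ENNReal.toReal ((hN.stationary t).measure_mem_eq (measurableSet_singleton k))

/-- The probability that the typical link delivers an update in the first slot. -/
lemma measureReal_reset [IsProbabilityMeasure P] (hpar : par.Admissible)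
    (hN : N.IsMeanFieldTSA par P) :
    P.real {ω | par.A < N.age par 0 ω ∧ N.ownCoin 0 ω = true ∧
      ENNReal.ofReal par.θ < N.sinr par 0 ω} =
      P.real {ω | par.A < N.age par 0 ω} * (par.η * N.successProb par P 0) := by
  have hA : MeasurableSet[N.sigma (ageSources 0)] {ω | par.A < N.age par 0 ω} :=
    N.measurable_age_sigma par 0 (measurableSet_Ioi (a := par.A))
  have hC : Measurable[N.sigma {.ownCoin 0}] (N.ownCoin 0) :=
    N.measurable_sigma (s := .ownCoin 0) rfl
  have hC' : MeasurableSet[N.sigma {.ownCoin 0}] {ω | N.ownCoin 0 ω = true} :=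
    hC (measurableSet_singleton true)
  have hS : MeasurableSet[N.sigma (sinrSources 0)] {ω | ENNReal.ofReal par.θ < N.sinr par 0 ω} :=
    N.measurable_sinr_sigma par 0 measurableSet_Ioi
  have hCS : MeasurableSet[N.sigma ({.ownCoin 0} ∪ sinrSources 0)]
      ({ω | N.ownCoin 0 ω = true} ∩ {ω | ENNReal.ofReal par.θ < N.sinr par 0 ω}) :=
    @MeasurableSet.inter _ (N.sigma _) _ _ (N.sigma_mono Set.subset_union_left _ hC')
      (N.sigma_mono Set.subset_union_right _ hS)
  have h1 := hN.measure_inter_of_disjoint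
    (by simp [ageSources, sinrSources, interferenceSources, markSources]) hA hCS
  rw [hN.measure_inter_of_disjoint
    (by simp [sinrSources, interferenceSources, markSources]) hC' hS, hN.ownCoin_law 0] at h1
  have h2 := congrArg ENNReal.toReal h1
  rw [ENNReal.toReal_mul, ENNReal.toReal_mul, ENNReal.toReal_ofReal hpar.η_pos.le] at h2
  exact h2

/-- The steady-state equation for the probability that the age exceeds the threshold. -/
lemma measureReal_threshold_lt_age [IsProbabilityMeasure P] (hpar : par.Admissible)
    (hN : N.IsMeanFieldTSA par P) :
    P.real {ω | par.A < N.age par 0 ω} * (1 + par.A * par.η * N.successProb par P 0) = 1 := by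
  have hage : ∀ ω, N.age par 1 ω = if par.A < N.age par 0 ω ∧ N.ownCoin 0 ω = true ∧
      ENNReal.ofReal par.θ < N.sinr par 0 ω then 1 else N.age par 0 ω + 1 := fun ω => rfl
  -- The initial age may be 0 pointwise, but no age in slot 1 is, and the two slots have the same
  -- law.
  have h0 : P.real {ω | N.age par 0 ω = 0} = 0 := by
    rw [← hN.measureReal_age_eq 1 0]
    have : {ω | N.age par 1 ω = 0} = ∅ := by
      ext ω
      simp only [Set.mem_ofPred_eq, Set.mem_empty_iff_false, iff_false]
      rw [hage]
      split_ifs <;> simp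
    rw [this, measureReal_empty]
  have h1 : P.real {ω | N.age par 0 ω = 1} =
      P.real {ω | par.A < N.age par 0 ω} * (par.η * N.successProb par P 0) := by
    rw [← hN.measureReal_age_eq 1 1, ← hN.measureReal_reset hpar]
    refine le_antisymm ?_ (measureReal_mono fun ω hω => ?_)
    -- Without a reset, age 1 in slot 1 can only come from age 0, a null event.
    · refine (measureReal_mono (s₂ := {ω | par.A < N.age par 0 ω ∧ N.ownCoin 0 ω = true ∧
        ENNReal.ofReal par.θ < N.sinr par 0 ω} ∪ {ω | N.age par 0 ω = 0}) fun ω hω => ?_).trans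
        ((measureReal_union_le _ _).trans_eq (by rw [h0, add_zero]))
      by_contra h
      simp only [Set.mem_union, Set.mem_ofPred_eq, not_or] at h hω
      rw [hage, if_neg h.1] at hω
      omega
    · simp only [Set.mem_ofPred_eq] at hω ⊢
      rw [hage, if_pos hω]
  -- Age k + 1 ≥ 2 is not a reset, and age k ≤ A forbids one, so the two events in slots 1 and 0
  -- coincide.
  have hstep : ∀ k, 1 ≤ k → k ≤ par.A →
      P.real {ω | N.age par 0 ω = k + 1} = P.real {ω | N.age par 0 ω = k} := by
    intro k hk hkA
    rw [← hN.measureReal_age_eq 1 (k + 1)]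
    congr 1 with ω
    simp only [Set.mem_ofPred_eq]
    rw [hage]
    split_ifs with h <;> omega
  have hconst : ∀ k < par.A, P.real {ω | N.age par 0 ω = k + 1} =
      P.real {ω | N.age par 0 ω = 1} := by
    intro k hk
    induction k with
    | zero => rfl
    | succ k ih => rw [hstep (k + 1) (by omega) (by omega), ih (by omega)]
  have hle : P.real {ω | N.age par 0 ω ≤ par.A} = par.A * P.real {ω | N.age par 0 ω = 1} := by
    have h := sum_measureReal_preimage_singleton (μ := P) (Finset.range (par.A + 1))
      (f := N.age par 0) (fun y _ => hN.measurable_age 0 (measurableSet_singleton y))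
    have hset : N.age par 0 ⁻¹' (Finset.range (par.A + 1) : Set ℕ) =
        {ω | N.age par 0 ω ≤ par.A} := by
      ext ω
      simp
    rw [hset, Finset.sum_range_succ'] at h
    rw [← h]
    refine (congrArg₂ (· + ·) (Finset.sum_congr rfl fun k hk =>
      hconst k (Finset.mem_range.1 hk)) h0).trans ?_
    simp
  have hcompl : P.real {ω | par.A < N.age par 0 ω} = 1 - P.real {ω | N.age par 0 ω ≤ par.A} := by
    refine Eq.trans ?_
      (probReal_compl_eq_one_sub (hN.measurable_age 0 (measurableSet_Iic (a := par.A))))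
    congr 1 with ω
    simp
  rw [hle, h1] at hcompl
  linarith

end IsMeanFieldTSA

end Network

end TSA

theorem theorem1 {Ω : Type*} [MeasurableSpace Ω] (P : Measure Ω) [IsProbabilityMeasure P]
    (par : TSA.Params) (hpar : par.Admissible) (N : TSA.Network Ω)
    (hN : N.IsMeanFieldTSA par P) :
    ∃ p : ℝ, (∀ t, N.successProb par P t = p) ∧
      p = Real.exp (-(par.lam * par.c * par.η * par.r ^ 2 / (1 + par.A * par.η * p))
        - par.θ * par.r ^ par.α / par.ρ) := by
  have hη := hpar.η_pos
  have hp : 0 ≤ N.successProb par P 0 := measureReal_nonneg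
  refine ⟨N.successProb par P 0, fun t => ?_, ?_⟩
  · rw [hN.successProb_eq_exp hpar t, hN.successProb_eq_exp hpar 0]
  · have h1 := hN.measureReal_threshold_lt_age hpar
    have h2 := eq_div_of_mul_eq (by positivity) h1
    -- Only the left-hand p is expanded: the p on the right must survive in the denominator, where
    -- it came from q = 1 / (1 + A η p).
    conv_lhs => rw [hN.successProb_eq_exp hpar 0, h2, one_div_mul_eq_div]
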